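/- **Proposition (Connecting Lemma).** Conventions. The $r$-th power of a graph $F$ has the same vertex set as $F$, and two distinct vertices are adjacent in it if and only if their distance in $F$ is at most $r$. An $r$-path in a graph $H$ is a (not necessarily induced) copy in $H$ of the $r$-th power of a path. An ordered $r$-clique of $H$ is a sequence of $r$ distinct, pairwise adjacent vertices of $H$. An $r$-path with vertices $v_1,\dots,v_m$ (in the order of the path), $m\ge r$, connects the ordered $r$-cliques $(v_1,\dots,v_r)$ and $(v_{m-r+1},\dots,v_m)$; its internal vertices are those of its vertices that lie in neither of these two cliques. $G(n,p)$ is the binomial random graph on $\{1,\dots,n\}$, in which every pair is an edge independently with probability $p$. For every integer $k\ge 0$ and every real $\varepsilon>0$ there exists a real $C>1$ such that the following holds. Let $(G_n)_{n\in\mathbb N}$ be a sequence of graphs, $G_n$ having vertex set $V_n=\{1,\dots,n\}$, and let $p\colon\mathbb N\to[0,1]$, such that for all sufficiently large $n$ $$\delta(G_n)\ \ge\ \Big(\frac{k}{k+1}+\varepsilon\Big)n\qquad\text{and}\qquad p(n)\ \ge\ \frac Cn .$$ Then, with probability tending to $1$ as $n\to\infty$, the graph $H=G_n\cup G(n,p(n))$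 has the following property: for every set $Z\subseteq V_n$ with $|Z|\le \varepsilon n/2$ and every pair of vertex-disjoint ordered $(k+1)$-cliques $K,K'$ of $H$, there exists a $(k+1)$-path in $H$ that connects $K$ and $K'$ and has exactly $(k+1)2^{k+1}$ internal vertices, all of which lie in $V_n\setminus Z$. -/

import Mathlib

/-- The `r`-th power of a graph `H`: the graph on the same vertex set in which two distinct
vertices are adjacent iff their distance in `H` is at most `r` (the distance between vertices in
different components is infinite). -/
def SimpleGraph.power {V : Type*} (H : SimpleGraph V) (r : ℕ) : SimpleGraph V where
  Adj u v := u ≠ v ∧ H.edist u v ≤ (r : ℕ∞)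
  symm := ⟨fun _ _ h => ⟨h.1.symm, by rw [SimpleGraph.edist_comm]; exact h.2⟩⟩
  loopless := ⟨fun _ h => h.1 rfl⟩

/-- `K 0, …, K (r - 1)` is an ordered `r`-clique of `H`: its vertices are distinct and pairwise
adjacent in `H`. -/
def IsOrderedClique {V : Type*} (H : SimpleGraph V) {r : ℕ} (K : Fin r → V) : Prop :=
  ∀ i j, i ≠ j → K i ≠ K j ∧ H.Adj (K i) (K j)

/-- An `r`-path in `H`: a copy in `H` of the `r`-th power of a path on `order` vertices.
The vertices of the `r`-path are `copy 0, …, copy (order - 1)`, in this order. -/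
structure PowerPath {V : Type*} (H : SimpleGraph V) (r : ℕ) where
  order : ℕ
  copy : SimpleGraph.Copy ((SimpleGraph.pathGraph order).power r) H

/-- The `r`-path `P` connects `K` and `K'`: its first `r` vertices, in order, are `K`,
and its last `r` vertices, in order, are `K'`. -/
def PowerPath.Connects {V : Type*} {H : SimpleGraph V} {r : ℕ} (P : PowerPath H r)
    (K K' : Fin r → V) : Prop :=
  ∃ h : r ≤ P.order,
    (∀ i : Fin r, P.copy ⟨i, lt_of_lt_of_le i.isLt h⟩ = K i) ∧
    (∀ i : Fin r, P.copy ⟨P.order - r + i, by have := i.isLt; omega⟩ = K' i)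

/-- The internal vertices of an `r`-path `P` that connects `K` and `K'`: the vertices of `P`
that belong neither to `K` nor to `K'`. -/
def PowerPath.internalVertices {V : Type*} {H : SimpleGraph V} {r : ℕ} (P : PowerPath H r)
    (K K' : Fin r → V) : Set V :=
  Set.range P.copy \ (Set.range K ∪ Set.range K')

/-!
Cut the path into `2 ^ (k + 1)` blocks of `k + 1` vertices. By the degree condition, any `k + 1`
vertices of `G` have linearly many common neighbours outside `Z`, and this alone yields a positive
proportion of all tuples as paths from `K` to `K'` in `G` that lack only the edges between vertices
at distance exactly `k + 1`. These are built one column at a time: a path with one column fewer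
inside the neighbourhood of a vertex `z` may receive `z` as its new entry in every block, Jensen's
inequality turns the single `z` into many independent choices, and gluing two such paths doubles
the number of blocks.

The missing edges form `k + 1` disjoint paths, which have to come from the random graph. Split it
into independent rounds, each of which adds one vertex in front of the tuples found so far; a round
turns a dense family of tuples into another dense one, except with probability `exp (-L * n)`, where
`L` is as large as we please. This beats the number of choices of `Z`, `K` and `K'`.
-/

section Density

open scoped Finset

/-- `P` holds for at least a `c`-fraction of the elements of `Ω`. If `Ω` is empty, this is true for
every `c`. -/
def HasDensity {Ω : Type*} [Fintype Ω] (c : ℝ) (P : Ω → Prop) : Prop :=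
  c * Fintype.card Ω ≤ Nat.card {ω // P ω}

variable {Ω Ω' : Type*} [Fintype Ω] [Fintype Ω'] {a b c : ℝ}

theorem hasDensity_iff_card_filter {P : Ω → Prop} [DecidablePred P] :
    HasDensity c P ↔ c * Fintype.card Ω ≤ #{ω | P ω} := by
  rw [HasDensity, Nat.card_eq_fintype_card, Fintype.card_subtype]

theorem natCard_subtype_prod {Ω Ω' : Type*} [Fintype Ω] [Finite Ω'] (R : Ω → Ω' → Prop) :
    Nat.card {x : Ω × Ω' // R x.1 x.2} = ∑ ω, Nat.card {η // R ω η} := by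
  classical
  have := Fintype.ofFinite Ω'
  simp only [Nat.card_eq_fintype_card, Fintype.card_subtype, Finset.card_filter,
    Fintype.sum_prod_type]

theorem hasDensity_one_of_forall {P : Ω → Prop} (h : ∀ ω, P ω) : HasDensity 1 P := by
  rw [HasDensity, Nat.card_congr (Equiv.subtypeUnivEquiv h), Nat.card_eq_fintype_card, one_mul]

theorem hasDensity_notMem {S : Finset Ω} (hS : #S ≤ b * Fintype.card Ω) :
    HasDensity (1 - b) (· ∉ S) := by
  classical
  have hcompl : (#{ω | ω ∉ S} : ℝ) = Fintype.card Ω - #S := by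
    rw [Finset.filter_notMem_eq_sdiff, ← Finset.compl_eq_univ_sdiff, Finset.card_compl,
      Nat.cast_sub (Finset.card_le_univ S)]
  rw [hasDensity_iff_card_filter, hcompl]
  linarith

namespace HasDensity

variable {P Q : Ω → Prop}

theorem mono (h : HasDensity c P) (hPQ : ∀ ω, P ω → Q ω) : HasDensity c Q :=
  h.trans <| mod_cast
    Nat.card_le_card_of_injective _ (Subtype.map_injective hPQ Function.injective_id)

theorem mono_left (h : HasDensity c P) (hbc : b ≤ c) : HasDensity b P :=
  (mul_le_mul_of_nonneg_right hbc (Nat.cast_nonneg _)).trans h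

theorem of_equiv {P : Ω' → Prop} (e : Ω ≃ Ω') (h : HasDensity c fun ω => P (e ω)) :
    HasDensity c P := by
  rwa [HasDensity, Fintype.card_congr e, Nat.card_congr (e.subtypeEquivOfSubtype (p := P))] at h

theorem exists_of_pos [Nonempty Ω] (h : HasDensity c P) (hc : 0 < c) : ∃ ω, P ω := by
  have hpos : (0 : ℝ) < Nat.card {ω // P ω} :=
    (mul_pos hc (Nat.cast_pos.2 Fintype.card_pos)).trans_le h
  obtain ⟨⟨ω, hω⟩⟩ := (Nat.card_pos_iff.1 (Nat.cast_pos.1 hpos)).1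
  exact ⟨ω, hω⟩

theorem le_one [Nonempty Ω] (h : HasDensity c P) : c ≤ 1 := by
  have hle : c * Fintype.card Ω ≤ Fintype.card Ω :=
    h.trans <| mod_cast Nat.card_eq_fintype_card (α := Ω) ▸ Finite.card_subtype_le P
  exact (mul_le_iff_le_one_left (Nat.cast_pos.2 Fintype.card_pos)).1 hle

theorem inter (hP : HasDensity a P) (hQ : HasDensity b Q) :
    HasDensity (a + b - 1) fun ω => P ω ∧ Q ω := by
  classical
  rw [hasDensity_iff_card_filter] at hP hQ ⊢
  have hincl_excl := Finset.card_union_add_card_inter {ω | P ω} {ω | Q ω}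
  rw [← Finset.filter_and] at hincl_excl
  have hcard : (#{ω | P ω} + #{ω | Q ω} : ℝ) ≤ Fintype.card Ω + #{ω | P ω ∧ Q ω} := by
    exact_mod_cast hincl_excl.ge.trans (Nat.add_le_add_right (Finset.card_le_univ _) _)
  linarith

theorem prod {Q : Ω → Ω' → Prop} (hb : 0 ≤ b) (hP : HasDensity a P)
    (hQ : ∀ ω, P ω → HasDensity b (Q ω)) :
    HasDensity (a * b) fun x : Ω × Ω' => P x.1 ∧ Q x.1 x.2 := by
  classical
  have hfiber : ∀ ω, (if P ω then b * Fintype.card Ω' else 0) ≤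
      (Nat.card {η // P ω ∧ Q ω η} : ℝ) := by
    intro ω
    split_ifs with h
    · simpa only [HasDensity, h, true_and] using hQ ω h
    · positivity
  calc a * b * Fintype.card (Ω × Ω')
      = (a * Fintype.card Ω) * (b * Fintype.card Ω') := by rw [Fintype.card_prod]; push_cast; ring
    _ ≤ #{ω | P ω} * (b * Fintype.card Ω') := by gcongr; exact hasDensity_iff_card_filter.1 hP
    _ = ∑ ω, if P ω then b * Fintype.card Ω' else 0 := by
        rw [← Finset.sum_filter, Finset.sum_const, nsmul_eq_mul]
    _ ≤ ∑ ω, (Nat.card {η // P ω ∧ Q ω η} : ℝ) := Finset.sum_le_sum fun ω _ => hfiber ω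
    _ = _ := by rw [natCard_subtype_prod fun ω η => P ω ∧ Q ω η, Nat.cast_sum]

theorem comp_fst (h : HasDensity c P) : HasDensity c fun x : Ω × Ω' => P x.1 := by
  simpa using h.prod zero_le_one fun _ _ => hasDensity_one_of_forall (Ω := Ω') fun _ => trivial

theorem of_comp_fst [Nonempty Ω'] (h : HasDensity c fun x : Ω × Ω' => P x.1) :
    HasDensity c P := by
  have hcard : Nat.card {x : Ω × Ω' // P x.1} = Nat.card {ω // P ω} * Fintype.card Ω' := by
    rw [Nat.card_congr (Equiv.prodSubtypeFstEquivSubtypeProd (p := P)), Nat.card_prod,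
      Nat.card_eq_fintype_card (α := Ω')]
  rw [HasDensity, hcard, Fintype.card_prod, Nat.cast_mul, Nat.cast_mul, ← mul_assoc] at h
  exact le_of_mul_le_mul_right h (Nat.cast_pos.2 Fintype.card_pos)

theorem of_comp_snd [Nonempty Ω'] (h : HasDensity c fun x : Ω' × Ω => P x.2) :
    HasDensity c P :=
  of_comp_fst (h.of_equiv (P := fun x : Ω × Ω' => P x.1) (Equiv.prodComm Ω' Ω))

/-- By Jensen's inequality for `t ↦ t ^ Fintype.card ι`, applied to the degrees of `R`. -/
theorem pi_left {R : Ω × Ω' → Prop} (hc : 0 ≤ c) (h : HasDensity c R)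
    (ι : Type*) [Fintype ι] [DecidableEq ι] :
    HasDensity (c ^ Fintype.card ι) fun x : (ι → Ω) × Ω' => ∀ j, R (x.1 j, x.2) := by
  rcases isEmpty_or_nonempty Ω' with hΩ' | hΩ'
  · simp [HasDensity]
  set N : ℝ := (Fintype.card Ω' : ℝ)
  set d : Ω' → ℝ := fun η => Nat.card {ω // R (ω, η)}
  have hN : 0 < N := Nat.cast_pos.2 Fintype.card_pos
  have hd : c * Fintype.card Ω ≤ ∑ η, N⁻¹ * d η := by
    have hswap := h.of_equiv (P := fun x : Ω' × Ω => R (x.2, x.1)) (Equiv.prodComm Ω Ω')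
    rw [HasDensity, natCard_subtype_prod fun η ω => R (ω, η), Fintype.card_prod] at hswap
    push_cast at hswap
    rw [← Finset.mul_sum, le_inv_mul_iff₀ hN]
    linarith
  have hpow : ∀ η, (Nat.card {f : ι → Ω // ∀ j, R (f j, η)} : ℝ) = d η ^ Fintype.card ι := by
    intro η
    rw [Nat.card_congr (Equiv.subtypePiEquivPi (p := fun _ ω => R (ω, η))), Nat.card_pi]
    simp [d]
  have hjensen : (∑ η, N⁻¹ * d η) ^ Fintype.card ι ≤ ∑ η, N⁻¹ * d η ^ Fintype.card ι :=
    Real.pow_arith_mean_le_arith_mean_pow _ _ _ (fun _ _ => by positivity)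
      (by simp [N]) (fun _ _ => Nat.cast_nonneg _) _
  suffices hswap : HasDensity (c ^ Fintype.card ι)
      fun x : Ω' × (ι → Ω) => ∀ j, R (x.2 j, x.1) from
    hswap.of_equiv (Equiv.prodComm Ω' (ι → Ω))
  rw [HasDensity, natCard_subtype_prod fun η (f : ι → Ω) => ∀ j, R (f j, η)]
  calc c ^ Fintype.card ι * Fintype.card (Ω' × (ι → Ω))
      = N * (c * Fintype.card Ω) ^ Fintype.card ι := by
        rw [Fintype.card_prod, Fintype.card_fun, mul_pow]; push_cast; ring
    _ ≤ N * ∑ η, N⁻¹ * d η ^ Fintype.card ι := by gcongr; exact le_trans (by gcongr) hjensen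
    _ = _ := by
      rw [← Finset.mul_sum, mul_inv_cancel_left₀ hN.ne']
      push_cast
      exact Finset.sum_congr rfl fun η _ => (hpow η).symm

theorem curry [Nonempty Ω'] {R : Ω × Ω' → Prop} (hc : 0 ≤ c) (h : HasDensity c R) :
    HasDensity (c / 2) fun ω => HasDensity (c / 2) fun η => R (ω, η) := by
  classical
  have hle : ∀ ω, (Nat.card {η // R (ω, η)} : ℝ) ≤
      (if HasDensity (c / 2) fun η => R (ω, η) then (Fintype.card Ω' : ℝ) else 0) +
        c / 2 * Fintype.card Ω' := by
    intro ω
    split_ifs with hω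
    · have hcard : (Nat.card {η // R (ω, η)} : ℝ) ≤ Fintype.card Ω' :=
        mod_cast Nat.card_eq_fintype_card (α := Ω') ▸ Finite.card_subtype_le _
      exact hcard.trans (le_add_of_nonneg_right (by positivity))
    · rw [zero_add]
      exact (not_le.1 hω).le
  rw [HasDensity, natCard_subtype_prod fun ω η => R (ω, η), Fintype.card_prod, Nat.cast_mul,
    Nat.cast_sum] at h
  have hsum := h.trans (Finset.sum_le_sum fun ω _ => hle ω)
  rw [Finset.sum_add_distrib, ← Finset.sum_filter, Finset.sum_const, Finset.sum_const,
    nsmul_eq_mul, nsmul_eq_mul, Finset.card_univ] at hsum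
  rw [hasDensity_iff_card_filter]
  refine le_of_mul_le_mul_right ?_ (Nat.cast_pos.2 (Fintype.card_pos (α := Ω')))
  linarith

end HasDensity

theorem hasDensity_injective (ι : Type*) [Fintype ι] [DecidableEq ι] [Nonempty Ω] :
    HasDensity (1 - Fintype.card ι ^ 2 / Fintype.card Ω)
      (Function.Injective : (ι → Ω) → Prop) := by
  classical
  set m := Fintype.card ι
  set N := Fintype.card Ω
  have hN : (0 : ℝ) < N := Nat.cast_pos.2 Fintype.card_pos
  rw [HasDensity, Nat.card_congr (Equiv.subtypeInjectiveEquivEmbedding ι Ω),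
    Nat.card_eq_fintype_card, Fintype.card_embedding_eq, Fintype.card_fun, Nat.cast_pow]
  rcases le_or_gt m N with hmN | hmN
  · have hmN' : (m : ℝ) ≤ N := Nat.cast_le.2 hmN
    have hbernoulli : 1 + m * -(m / N : ℝ) ≤ (1 + -(m / N : ℝ)) ^ m :=
      one_add_mul_le_pow (by linarith [(div_le_one hN).2 hmN']) m
    calc (1 - (m : ℝ) ^ 2 / N) * N ^ m = (1 + m * -(m / N : ℝ)) * N ^ m := by ring
      _ ≤ (1 + -(m / N : ℝ)) ^ m * N ^ m := by gcongr
      _ = (N - m : ℝ) ^ m := by rw [← mul_pow]; congr 1; field_simp; ring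
      _ ≤ ((N + 1 - m : ℕ) : ℝ) ^ m := by
        rw [Nat.cast_sub (by omega), Nat.cast_succ]
        gcongr
        linarith
      _ ≤ _ := mod_cast Nat.pow_sub_le_descFactorial N m
  · have hmN' : (N : ℝ) ≤ m := Nat.cast_le.2 hmN.le
    refine (mul_nonpos_of_nonpos_of_nonneg ?_ (by positivity)).trans (Nat.cast_nonneg _)
    rw [sub_nonpos, one_le_div hN]
    nlinarith [Nat.one_le_cast (α := ℝ).2 (Nat.one_le_of_lt hmN)]

end Density

theorem isOrderedClique_iff_pairwise {V : Type*} {G : SimpleGraph V} {r : ℕ} {K : Fin r → V} :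
    IsOrderedClique G K ↔ Pairwise fun i j => G.Adj (K i) (K j) :=
  ⟨fun h _ _ hij => (h _ _ hij).2, fun h _ _ hij => ⟨(h hij).ne, h hij⟩⟩

theorem IsOrderedClique.injective {V : Type*} {G : SimpleGraph V} {r : ℕ} {K : Fin r → V}
    (hK : IsOrderedClique G K) : Function.Injective K :=
  Function.injective_iff_pairwise_ne.2 fun _ _ hij => (hK _ _ hij).1

theorem IsOrderedClique.cons {V : Type*} {G : SimpleGraph V} {r : ℕ} {K : Fin r → V} {v : V}
    (hK : IsOrderedClique G K) (hv : ∀ i, G.Adj v (K i)) :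
    IsOrderedClique G (Fin.cons v K : Fin (r + 1) → V) := by
  rw [isOrderedClique_iff_pairwise] at hK ⊢
  exact pairwise_fin_succ_iff.2 ⟨fun i => (hv i).symm, hv, hK⟩

theorem IsOrderedClique.comp_injective {V : Type*} {G : SimpleGraph V} {r s : ℕ} {K : Fin r → V}
    (hK : IsOrderedClique G K) {f : Fin s → Fin r} (hf : Function.Injective f) :
    IsOrderedClique G (K ∘ f) :=
  fun _ _ hij => hK _ _ (hf.ne hij)

section RichSets

open scoped Finset

/-- Any `r` vertices have at least `γ * Fintype.card V` common neighbours in `U`: this is what makes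
a greedy embedding into `U` possible. -/
def IsRich {V : Type*} [Fintype V] (G : SimpleGraph V) (γ : ℝ) (r : ℕ) (U : Set V) : Prop :=
  ∀ T : Finset V, #T ≤ r → HasDensity γ fun u => u ∈ U ∧ ∀ v ∈ T, G.Adj v u

variable {V : Type*} [Fintype V] {G : SimpleGraph V} {γ δ : ℝ} {r : ℕ} {U : Set V}

theorem isRich_of_hasDensity (hδ : 0 ≤ δ) (hG : ∀ v, HasDensity (1 - δ) (G.Adj v))
    (hU : HasDensity (γ + r * δ) (· ∈ U)) : IsRich G γ r U := by
  classical
  have hcommon : ∀ T : Finset V,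
      HasDensity (γ + r * δ - #T * δ) fun u => u ∈ U ∧ ∀ v ∈ T, G.Adj v u := by
    intro T
    induction T using Finset.induction with
    | empty => simpa using hU
    | insert v T hv ih =>
      refine ((ih.inter (hG v)).mono_left ?_).mono fun u hu => ?_
      · rw [Finset.card_insert_of_notMem hv, Nat.cast_succ]
        linarith
      · exact ⟨hu.1.1, (Finset.forall_mem_insert ..).2 ⟨hu.2, hu.1.2⟩⟩
  intro T hT
  refine (hcommon T).mono_left ?_
  have hTr : (#T : ℝ) * δ ≤ r * δ := by gcongr
  linarith

theorem IsRich.inter_neighborSet (hU : IsRich G γ (r + 1) U) (z : V) :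
    IsRich G γ r (U ∩ G.neighborSet z) := by
  classical
  intro T hT
  refine (hU (insert z T) ((Finset.card_insert_le _ _).trans (by lia))).mono fun u hu => ?_
  have hadj := (Finset.forall_mem_insert ..).1 hu.2
  exact ⟨⟨hu.1, hadj.1⟩, hadj.2⟩

theorem IsRich.hasDensity_adj {ι : Type*} [Fintype ι] (hU : IsRich G γ r U)
    (hι : Fintype.card ι ≤ r) (K : ι → V) :
    HasDensity γ fun z => z ∈ U ∧ ∀ i, G.Adj z (K i) := by
  classical
  exact (hU (Finset.univ.image K) (Finset.card_image_le.trans hι)).mono fun z hz =>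
    ⟨hz.1, fun i => (hz.2 _ (Finset.mem_image_of_mem K (Finset.mem_univ i))).symm⟩

theorem IsRich.hasDensity_isOrderedClique (hU : IsRich G γ r U) (hγ : 0 ≤ γ) {m : ℕ}
    (T : Fin m → Finset V) (hT : ∀ i, #(T i) + i ≤ r) :
    HasDensity (γ ^ m) fun K : Fin m → V =>
      IsOrderedClique G K ∧ ∀ i, K i ∈ U ∧ ∀ v ∈ T i, G.Adj v (K i) := by
  classical
  induction m with
  | zero => exact pow_zero γ ▸ hasDensity_one_of_forall fun K => ⟨nofun, nofun⟩
  | succ m ih =>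
    have htail (u : V) := ih (fun i => insert u (T i.succ)) fun i => by
      have hcard := Finset.card_insert_le u (T i.succ)
      have hTi := hT i.succ
      rw [Fin.val_succ] at hTi
      lia
    rw [pow_succ']
    refine HasDensity.of_equiv (Fin.consEquiv fun _ => V)
      (((hU (T 0) (by simpa using hT 0)).prod (pow_nonneg hγ m) fun u _ => htail u).mono ?_)
    rintro ⟨u, K⟩ ⟨hu, hK, hKU⟩
    simp only [Finset.forall_mem_insert] at hKU
    exact ⟨hK.cons fun i => (hKU i).2.1,
      Fin.forall_fin_succ.2 ⟨hu, fun i => ⟨(hKU i).1, (hKU i).2.2⟩⟩⟩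

theorem IsRich.hasDensity_isOrderedClique_rev (hU : IsRich G γ r U) (hγ : 0 ≤ γ) {m : ℕ}
    (T : Fin m → Finset V) (hT : ∀ i, #(T i) + i.rev ≤ r) :
    HasDensity (γ ^ m) fun K : Fin m → V =>
      IsOrderedClique G K ∧ ∀ i, K i ∈ U ∧ ∀ v ∈ T i, G.Adj v (K i) := by
  refine HasDensity.of_equiv (Fin.revPerm.arrowCongr (Equiv.refl V))
    ((hU.hasDensity_isOrderedClique hγ (T ∘ Fin.rev) fun i => ?_).mono fun K hK => ?_)
  · simpa using hT i.rev
  · refine ⟨hK.1.comp_injective Fin.rev_injective, fun i => ?_⟩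
    simpa using hK.2 i.rev

end RichSets

section Walks

open scoped Finset

variable {V : Type*} {G : SimpleGraph V} {r m : ℕ}

/-- The adjacencies between two consecutive blocks of `r` vertices of an `r`-path, except those
between vertices at distance exactly `r` on the path. -/
def IsStep (G : SimpleGraph V) (K L : Fin r → V) : Prop :=
  ∀ i j, j < i → G.Adj (K i) (L j)

/-- The adjacencies between two consecutive blocks of `r` vertices of an `r`-path. -/
def IsFullStep (G : SimpleGraph V) (K L : Fin r → V) : Prop :=
  ∀ i j, j ≤ i → G.Adj (K i) (L j)

/-- The blocks of an `r`-path, from which the edges joining vertices at distance exactly `r` on the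
path may be missing. -/
def IsWalk (G : SimpleGraph V) (l : List (Fin r → V)) : Prop :=
  l.IsChain (IsStep G) ∧ ∀ K ∈ l, IsOrderedClique G K

theorem IsStep.cons {K L : Fin r → V} {u v : V} (h : IsStep G K L) (hv : ∀ i, G.Adj v (K i)) :
    IsStep G (Fin.cons u K : Fin (r + 1) → V) (Fin.cons v L : Fin (r + 1) → V) := by
  intro i j hij
  cases i using Fin.cases with
  | zero => exact absurd hij (Fin.not_lt_zero j)
  | succ i =>
    cases j using Fin.cases with
    | zero => exact (hv i).symm
    | succ j => exact h i j (Fin.succ_lt_succ_iff.1 hij)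

theorem isWalk_cons_cons {K L : Fin r → V} {l : List (Fin r → V)} :
    IsWalk G (K :: L :: l) ↔ (IsOrderedClique G K ∧ IsStep G K L) ∧ IsWalk G (L :: l) := by
  simp only [IsWalk, List.isChain_cons_cons, List.forall_mem_cons]
  tauto

theorem isWalk_singleton {K : Fin r → V} : IsWalk G [K] ↔ IsOrderedClique G K := by
  simp [IsWalk]

theorem isWalk_split {K : Fin r → V} {l₁ l₂ : List (Fin r → V)} :
    IsWalk G (l₁ ++ K :: l₂) ↔ IsWalk G (l₁ ++ [K]) ∧ IsWalk G (K :: l₂) := by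
  simp only [IsWalk, List.isChain_split (l₂ := l₂), List.forall_mem_append, List.forall_mem_cons]
  tauto

/-- Puts the vertices `z 0, …, z (m - 1)` in front of the blocks `W 0, …, W (m - 1)`. -/
def addColumn (z : Fin m → V) (W : Fin m → Fin r → V) : Fin m → Fin (r + 1) → V :=
  fun a => Fin.cons (z a) (W a)

theorem ofFn_snoc {α : Type*} (f : Fin m → α) (x : α) :
    List.ofFn (Fin.snoc f x : Fin (m + 1) → α) = List.ofFn f ++ [x] := by
  rw [List.ofFn_succ']
  simp

theorem addColumn_snoc (z : Fin (m + 1) → V) (W : Fin m → Fin r → V) (q : Fin r → V) :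
    addColumn z (Fin.snoc W q : Fin (m + 1) → Fin r → V) =
      (Fin.snoc (addColumn (Fin.init z) W) (Fin.cons (z (Fin.last m)) q) :
        Fin (m + 1) → Fin (r + 1) → V) := by
  ext a : 1
  cases a using Fin.lastCases <;> simp [addColumn, Fin.init]

theorem IsWalk.addColumn {p : Fin r → V} {W : Fin m → Fin r → V} {u : V} {z : Fin m → V}
    (hW : IsWalk G (p :: List.ofFn W)) (hu : ∀ i, G.Adj u (p i)) (hp : ∀ a i, G.Adj (z a) (p i))
    (hz : ∀ a b i, G.Adj (z a) (W b i)) :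
    IsWalk G ((Fin.cons u p : Fin (r + 1) → V) :: List.ofFn (addColumn z W)) := by
  induction m generalizing p u with
  | zero =>
    rw [List.ofFn_zero] at hW ⊢
    exact isWalk_singleton.2 ((isWalk_singleton.1 hW).cons hu)
  | succ m ih =>
    rw [List.ofFn_succ, isWalk_cons_cons] at hW ⊢
    exact ⟨⟨hW.1.1.cons hu, hW.1.2.cons (hp 0)⟩,
      ih hW.2 (hz 0 0) (fun a i => hz a.succ 0 i) fun a b i => hz a.succ b.succ i⟩

end Walks

section WalkDensity

universe u

variable {V : Type*} {G : SimpleGraph V} {r m : ℕ}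

/-- The two parts of a walk of `r + 1` columns are walks of `r` columns behind a new first column;
they meet in the block `Fin.cons (z (Fin.last m)) q`. -/
theorem isWalk_append_addColumn {x y : Fin (r + 1) → V} {q y' : Fin r → V}
    {z z' : Fin (m + 1) → V} {w w' : Fin m → Fin r → V}
    (hx : IsOrderedClique G x) (hy : IsOrderedClique G y)
    (hw : ∀ u, (∀ i, G.Adj u (x (Fin.succ i))) → IsWalk G
      ((Fin.cons u (Fin.tail x) : Fin (r + 1) → V) ::
        List.ofFn (addColumn z (Fin.snoc w q : Fin (m + 1) → Fin r → V))))
    (hw' : ∀ u, (∀ i, G.Adj u (q i)) → IsWalk G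
      ((Fin.cons u q : Fin (r + 1) → V) ::
        List.ofFn (addColumn z' (Fin.snoc w' y' : Fin (m + 1) → Fin r → V))))
    (hz : ∀ i, G.Adj (z (Fin.last m)) (q i))
    (hstep : IsStep G (Fin.cons (z' (Fin.last m)) y' : Fin (r + 1) → V) y) :
    IsWalk G (x :: List.ofFn (Fin.append
      (addColumn z (Fin.snoc w q : Fin (m + 1) → Fin r → V))
      (addColumn z' (Fin.snoc w' y' : Fin (m + 1) → Fin r → V))) ++ [y]) := by
  have hfirst := hw (x 0) fun i => (hx _ _ (Fin.succ_ne_zero i).symm).2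
  have hsecond := hw' _ hz
  rw [Fin.cons_self_tail, addColumn_snoc, ofFn_snoc] at hfirst
  rw [addColumn_snoc, ofFn_snoc] at hsecond
  have hlast : IsOrderedClique G (Fin.cons (z' (Fin.last m)) y' : Fin (r + 1) → V) :=
    hsecond.2 _ (by simp)
  rw [List.ofFn_fin_append, addColumn_snoc, addColumn_snoc, ofFn_snoc, ofFn_snoc,
    List.cons_append, List.append_assoc, List.append_assoc, List.singleton_append,
    ← List.cons_append, isWalk_split]
  refine ⟨hfirst, ?_⟩
  rw [List.append_assoc, List.singleton_append, ← List.cons_append, isWalk_split]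
  exact ⟨hsecond, isWalk_cons_cons.2 ⟨⟨hlast, hstep⟩, isWalk_singleton.2 hy⟩⟩

/-- Splits blocks of `r + 1` columns into the first column, the rest of the last block, and the
rest of the other blocks. -/
def blocksEquiv (V : Type*) (m r : ℕ) :
    (Fin (m + 1) → V) × (Fin r → V) × (Fin m → Fin r → V) ≃ (Fin (m + 1) → Fin (r + 1) → V) where
  toFun x := addColumn x.1 (Fin.snoc x.2.2 x.2.1 : Fin (m + 1) → Fin r → V)
  invFun W := (fun a => W a 0, Fin.tail (W (Fin.last m)), fun a => Fin.tail (W a.castSucc))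
  left_inv x := by simp [addColumn]
  right_inv W := by
    ext a : 1
    cases a using Fin.lastCases <;> simp [addColumn]

/-- Assembles two halves with last blocks `Fin.cons _ q` and `Fin.cons _ y'` from `y'`, `q`, and the
first column and the other blocks of either half. -/
def halvesEquiv (V : Type*) (m r : ℕ) :
    (Fin r → V) × (Fin r → V) ×
      ((Fin (m + 1) → V) × (Fin m → Fin r → V)) × ((Fin (m + 1) → V) × (Fin m → Fin r → V)) ≃
      (Fin ((m + 1) + (m + 1)) → Fin (r + 1) → V) :=
  Equiv.trans
    { toFun x := ((x.2.2.1.1, x.2.1, x.2.2.1.2), (x.2.2.2.1, x.1, x.2.2.2.2))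
      invFun x := (x.2.2.1, x.1.2.1, (x.1.1, x.1.2.2), (x.2.1, x.2.2.2))
      left_inv _ := rfl
      right_inv _ := rfl }
    (((blocksEquiv V m r).prodCongr (blocksEquiv V m r)).trans
      (Fin.appendEquiv (m + 1) (m + 1)))

variable [Fintype V] {γ c d : ℝ} {U : Set V}

theorem IsRich.hasDensity_common_clique [Nonempty V] (hU : IsRich G γ (r + 1) U) (hγ : 0 < γ)
    (p p' : Fin r → V) :
    HasDensity (γ * (γ * γ ^ r) / 2) fun q : Fin r → V =>
      IsOrderedClique G q ∧ (∀ i, q i ∈ U) ∧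
      HasDensity (γ * (γ * γ ^ r) / 2)
        (fun z => z ∈ U ∧ (∀ i, G.Adj z (p i)) ∧ ∀ i, G.Adj z (q i)) ∧
      HasDensity (γ * (γ * γ ^ r) / 2)
        (fun z => z ∈ U ∧ (∀ i, G.Adj z (p' i)) ∧ ∀ i, G.Adj z (q i)) := by
  classical
  have hz (p : Fin r → V) : HasDensity γ fun z => z ∈ U ∧ ∀ i, G.Adj z (p i) :=
    hU.hasDensity_adj (by simp) p
  have hq (z z' : V) := hU.hasDensity_isOrderedClique hγ.le (m := r) (fun _ => {z, z'}) fun i => by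
    have hcard := Finset.card_le_two (a := z) (b := z')
    lia
  have htriple := (hz p).prod (by positivity) fun z _ =>
    (hz p').prod (by positivity) fun z' _ => hq z z'
  have htriple' : HasDensity (γ * (γ * γ ^ r)) fun x : (Fin r → V) × V × V =>
      (x.2.1 ∈ U ∧ ∀ i, G.Adj x.2.1 (p i)) ∧ (x.2.2 ∈ U ∧ ∀ i, G.Adj x.2.2 (p' i)) ∧
        IsOrderedClique G x.1 ∧
        ∀ i, x.1 i ∈ U ∧ ∀ v ∈ ({x.2.1, x.2.2} : Finset V), G.Adj v (x.1 i) :=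
    htriple.of_equiv ((Equiv.prodAssoc V V (Fin r → V)).symm.trans (Equiv.prodComm _ _))
  refine (htriple'.curry (by positivity)).mono fun q hpairs => ?_
  simp only [Finset.forall_mem_insert, Finset.mem_singleton, forall_eq] at hpairs
  obtain ⟨_, _, _, hclique, hqU⟩ := hpairs.exists_of_pos (by positivity)
  refine ⟨hclique, fun i => (hqU i).1, ?_, ?_⟩
  · refine HasDensity.of_comp_fst (Ω' := V) (hpairs.mono ?_)
    exact fun x hx => ⟨hx.1.1, hx.1.2, fun i => (hx.2.2.2 i).2.1⟩
  · refine HasDensity.of_comp_snd (Ω' := V) (hpairs.mono ?_)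
    exact fun x hx => ⟨hx.2.1.1, hx.2.1.2, fun i => (hx.2.2.2 i).2.2⟩

/-- One vertex `z` in front of all blocks would do, except that the new column has to consist of
many choices; hence the power `m + 1`. -/
theorem hasDensity_addColumn {p q : Fin r → V} (hc : 0 ≤ c) (hd : 0 ≤ d) (hq : ∀ i, q i ∈ U)
    (hz : HasDensity d fun z => z ∈ U ∧ (∀ i, G.Adj z (p i)) ∧ ∀ i, G.Adj z (q i))
    (hw : ∀ z, HasDensity c fun w : Fin m → Fin r → V =>
      (∀ b i, w b i ∈ U ∩ G.neighborSet z) ∧ IsWalk G (p :: List.ofFn w ++ [q])) :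
    HasDensity ((d * c) ^ (m + 1)) fun x : (Fin (m + 1) → V) × (Fin m → Fin r → V) =>
      (∀ b i, addColumn x.1 (Fin.snoc x.2 q : Fin (m + 1) → Fin r → V) b i ∈ U) ∧
      (∀ b i, G.Adj (x.1 b) (q i)) ∧
      ∀ u, (∀ i, G.Adj u (p i)) → IsWalk G ((Fin.cons u p : Fin (r + 1) → V) ::
        List.ofFn (addColumn x.1 (Fin.snoc x.2 q : Fin (m + 1) → Fin r → V))) := by
  have hcolumn := (hz.prod hc fun z _ => hw z).pi_left (mul_nonneg hd hc) (Fin (m + 1))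
  rw [Fintype.card_fin] at hcolumn
  refine hcolumn.mono ?_
  rintro ⟨z, w⟩ h
  refine ⟨fun b => Fin.forall_fin_succ.2 ⟨(h b).1.1, ?_⟩, fun b => (h b).1.2.2, fun u hu => ?_⟩
  · cases b using Fin.lastCases with
    | last => simpa [addColumn] using hq
    | cast b => simpa [addColumn] using fun i => ((h 0).2.1 b i).1
  · refine IsWalk.addColumn ?_ hu (fun a => (h a).1.2.1) fun a b i => ?_
    · rw [ofFn_snoc]
      exact (h 0).2.2
    · cases b using Fin.lastCases with
      | last => simpa using (h a).1.2.2 i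
      | cast b => simpa using ((h a).2.1 b i).2

theorem IsRich.hasDensity_isWalk_succ (hU : IsRich G γ (r + 1) U) (hγ : 0 < γ) (hc : 0 ≤ c)
    (hd : d = γ * (γ * γ ^ r) / 2)
    (hw : ∀ z, ∀ p q : Fin r → V, IsOrderedClique G p → IsOrderedClique G q →
      HasDensity c fun w : Fin m → Fin r → V =>
        (∀ b i, w b i ∈ U ∩ G.neighborSet z) ∧ IsWalk G (p :: List.ofFn w ++ [q]))
    {x y : Fin (r + 1) → V} (hx : IsOrderedClique G x) (hy : IsOrderedClique G y) :
    HasDensity (γ ^ r * (d * ((d * c) ^ (m + 1) * (d * c) ^ (m + 1))))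
      fun w : Fin ((m + 1) + (m + 1)) → Fin (r + 1) → V =>
        (∀ b i, w b i ∈ U) ∧ IsWalk G (x :: List.ofFn w ++ [y]) := by
  classical
  have : Nonempty V := ⟨x 0⟩
  have hdpos : 0 < d := hd ▸ by positivity
  have hy' := hU.hasDensity_isOrderedClique_rev hγ.le (m := r)
    (fun i => (Finset.Iio i.succ).image y) fun i => by
      have hcard := Finset.card_image_le (s := Finset.Iio i.succ) (f := y)
      rw [Fin.card_Iio, Fin.val_succ] at hcard
      rw [Fin.val_rev]
      lia
  have hq (y' : Fin r → V) := hU.hasDensity_common_clique hγ (Fin.tail x) y'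
  rw [← hd] at hq
  have hhalves := hy'.prod (by positivity) fun y' hy' => (hq y').prod (by positivity) fun q hq =>
    (hasDensity_addColumn hc hdpos.le hq.2.1 hq.2.2.1
      fun z => hw z _ _ (hx.comp_injective (Fin.succ_injective _)) hq.1).prod (by positivity)
        fun _ _ => hasDensity_addColumn hc hdpos.le (fun i => (hy'.2 i).1)
          (hq.2.2.2.mono fun z hz => ⟨hz.1, hz.2.symm⟩) fun z => hw z _ _ hq.1 hy'.1
  refine HasDensity.of_equiv (halvesEquiv V m r) (hhalves.mono ?_)
  rintro ⟨y', q, ⟨z, w⟩, ⟨z', w'⟩⟩ ⟨hy', -, hw, hw'⟩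
  refine ⟨fun b => ?_, isWalk_append_addColumn hx hy hw.2.2 hw'.2.2 (hw.2.1 _) ?_⟩
  · change ∀ i, Fin.append (α := Fin (r + 1) → V) _ _ b i ∈ U
    cases b using Fin.addCases with
    | left b => rw [Fin.append_left]; exact hw.1 b
    | right b => rw [Fin.append_right]; exact hw'.1 b
  · intro i j hij
    cases i using Fin.cases with
    | zero => exact absurd hij (Fin.not_lt_zero j)
    | succ i =>
      exact ((hy'.2 i).2 _ (Finset.mem_image_of_mem y (Finset.mem_Iio.2 hij))).symm

theorem exists_hasDensity_isWalk {γ : ℝ} (hγ : 0 < γ) (s m : ℕ) (hm : m + 2 = 2 ^ (s + 1)) :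
    ∃ c > 0, ∀ {V : Type u} [Fintype V] (G : SimpleGraph V) (U : Set V),
      IsRich G γ (s + 1) U → ∀ x y : Fin (s + 1) → V, IsOrderedClique G x → IsOrderedClique G y →
        HasDensity c fun w : Fin m → Fin (s + 1) → V =>
          (∀ b i, w b i ∈ U) ∧ IsWalk G (x :: List.ofFn w ++ [y]) := by
  induction s generalizing m with
  | zero =>
    obtain rfl : m = 0 := by lia
    refine ⟨1, one_pos, fun G U _ x y hx hy => hasDensity_one_of_forall fun w => ⟨nofun, ?_⟩⟩
    rw [List.ofFn_zero]
    exact isWalk_cons_cons.2 ⟨⟨hx, fun i j hij => by lia⟩, isWalk_singleton.2 hy⟩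
  | succ s ih =>
    obtain ⟨l, rfl⟩ : ∃ l, m = (l + 1) + (l + 1) := ⟨2 ^ (s + 1) - 2, by
      have := Nat.pow_le_pow_right two_pos (Nat.le_add_left 1 s)
      lia⟩
    obtain ⟨c, hc, hwalks⟩ := ih l (by lia)
    exact ⟨_, by positivity, fun G U hU x y hx hy =>
      hU.hasDensity_isWalk_succ hγ hc.le rfl
        (fun z p q => hwalks G _ (hU.inter_neighborSet z) p q) hx hy⟩

/-- The internal blocks of an `r`-path connecting `K` and `K'`, from which the edges joining
internal vertices at distance exactly `r` on the path may be missing. -/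
structure IsConnector (G : SimpleGraph V) (K K' : Fin r → V) (B : Fin (m + 2) → Fin r → V) :
    Prop where
  first : IsFullStep G K (B 0)
  last : IsFullStep G (B (Fin.last (m + 1))) K'
  isWalk : IsWalk G (List.ofFn B)

theorem exists_hasDensity_isConnector {γ : ℝ} (hγ : 0 < γ) (k m : ℕ) (hm : m + 2 = 2 ^ (k + 1)) :
    ∃ c > 0, ∀ {V : Type u} [Fintype V] (G : SimpleGraph V) (U : Set V),
      IsRich G γ (k + 1) U → ∀ K K' : Fin (k + 1) → V,
        HasDensity c fun B : Fin (m + 2) → Fin (k + 1) → V =>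
          (∀ b i, B b i ∈ U) ∧ IsConnector G K K' B := by
  classical
  obtain ⟨c, hc, hwalks⟩ := exists_hasDensity_isWalk hγ k m hm
  refine ⟨γ ^ (k + 1) * (γ ^ (k + 1) * c), by positivity, fun {V} _ G U hU K K' => ?_⟩
  have hx := hU.hasDensity_isOrderedClique hγ.le (fun i => (Finset.Ici i).image K) fun i => by
    have hcard := Finset.card_image_le (s := Finset.Ici i) (f := K)
    rw [Fin.card_Ici] at hcard
    lia
  have hy := hU.hasDensity_isOrderedClique_rev hγ.le (fun i => (Finset.Iic i).image K') fun i => by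
    have hcard := Finset.card_image_le (s := Finset.Iic i) (f := K')
    rw [Fin.card_Iic] at hcard
    rw [Fin.val_rev]
    lia
  refine HasDensity.of_equiv (((Equiv.refl _).prodCongr (Fin.snocEquiv fun _ => _)).trans
    (Fin.consEquiv fun _ => _)) ((hx.prod (by positivity) fun x hx => hy.prod hc.le fun y hy =>
      hwalks G U hU x y hx.1 hy.1).mono ?_)
  rintro ⟨x, y, w⟩ ⟨hx, hy, hw⟩
  refine ⟨Fin.forall_fin_succ.2 ⟨fun i => (hx.2 i).1, fun b => ?_⟩, fun i j hij => ?_,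
    fun i j hij => ?_, ?_⟩
  · cases b using Fin.lastCases with
    | last => simpa using fun i => (hy.2 i).1
    | cast b => simpa using hw.1 b
  · exact (hx.2 j).2 _ (Finset.mem_image_of_mem K (Finset.mem_Ici.2 hij))
  · simpa [← Fin.succ_last] using
      ((hy.2 i).2 _ (Finset.mem_image_of_mem K' (Finset.mem_Iic.2 hij))).symm
  · change IsWalk G (List.ofFn (Fin.cons x (Fin.snoc w y : Fin (m + 1) → Fin (k + 1) → V) :
      Fin (m + 2) → Fin (k + 1) → V))
    rw [List.ofFn_cons, ofFn_snoc]
    exact hw.2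

end WalkDensity

section RandomGraph

open MeasureTheory ProbabilityTheory unitInterval
open scoped Finset SimpleGraph

theorem measureReal_exists_le {α ι : Type*} [MeasurableSpace α] [Fintype ι] (μ : Measure α)
    {Q : ι → Prop} {A : ι → α → Prop} {b : ℝ} (hb : 0 ≤ b)
    (h : ∀ i, Q i → μ.real {x | A i x} ≤ b) :
    μ.real {x | ∃ i, Q i ∧ A i x} ≤ Fintype.card ι * b := by
  have hQ : ∀ i, μ.real {x | Q i ∧ A i x} ≤ b := by
    intro i
    by_cases hi : Q i
    · simpa only [hi, true_and] using h i hi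
    · simpa [hi] using hb
  rw [Set.ofPred_exists, ← nsmul_eq_mul]
  exact (measureReal_iUnion_fintype_le _).trans (Finset.sum_le_card_nsmul _ _ _ fun i _ => hQ i)

theorem measure_ext_of_Iic {α : Type*} [Finite α] [PartialOrder α] [MeasurableSpace α]
    [MeasurableSingletonClass α] (μ ν : Measure α) [IsFiniteMeasure ν]
    (h : ∀ a, μ (Set.Iic a) = ν (Set.Iic a)) : μ = ν := by
  classical
  have := Fintype.ofFinite α
  have hIic : ∀ (ρ : Measure α) (a : α), ρ (Set.Iic a) = ρ {a} + ∑ b with b < a, ρ {b} := by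
    intro ρ a
    rw [← Set.Iio_insert, Set.insert_eq, measure_union (by simp) (Set.toFinite _).measurableSet,
      sum_measure_singleton]
    simp [Set.Iio_def]
  refine Measure.ext_of_singleton fun a => ?_
  induction a using WellFoundedLT.induction with
  | ind a ih =>
    have ha := h a
    rw [hIic, hIic, Finset.sum_congr rfl fun b hb => ih b (by simpa using hb)] at ha
    exact (ENNReal.add_left_inj (ENNReal.sum_lt_top.2 fun _ _ => measure_lt_top _ _).ne).1 ha

variable {V : Type*}

instance discreteMeasurableSpace_simpleGraph [Finite V] :
    DiscreteMeasurableSpace (SimpleGraph V) where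
  forall_measurableSet S := by
    rw [← SimpleGraph.measurableEmbedding_edgeSet.measurableSet_image]
    exact (Set.toFinite _).measurableSet

theorem binomialRandom_disjoint [Finite V] (p : I) (D : SimpleGraph V) :
    G(V, p) {Γ | Disjoint Γ D} = (toNNReal (σ p) : ENNReal) ^ D.edgeSet.ncard := by
  classical
  have := Fintype.ofFinite V
  have hbox : (fun s : Sym2 V → Prop => {e | s e}) ⁻¹' (SimpleGraph.fromEdgeSet ⁻¹'
      {Γ : SimpleGraph V | Disjoint Γ D}) = Set.pi (D.edgeFinset : Set (Sym2 V))
        (fun _ => {False}) := by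
    ext s
    simp only [Set.mem_preimage, Set.mem_ofPred_eq, Set.mem_pi, SimpleGraph.coe_edgeFinset,
      SimpleGraph.disjoint_fromEdgeSet, disjoint_comm (b := D), Set.disjoint_left]
    simp
  rw [SimpleGraph.binomialRandom_eq_map, Measure.map_apply SimpleGraph.measurable_fromEdgeSet
    .of_discrete, setBernoulli_apply', hbox, Measure.infinitePi_pi _ fun _ _ => by measurability,
    Set.ncard_eq_toFinset_card', ← SimpleGraph.edgeFinset, ← Finset.prod_const]
  refine Finset.prod_congr rfl fun e he => ?_
  simp [SimpleGraph.not_isDiag_of_mem_edgeSet D (SimpleGraph.mem_edgeFinset.1 he)]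

theorem binomialRandom_eq_map_sup [Finite V] {p p₁ p₂ : I} (h : σ p = σ p₁ * σ p₂) :
    G(V, p) = (G(V, p₁).prod G(V, p₂)).map fun x => x.1 ⊔ x.2 := by
  have hsup : Measurable fun x : SimpleGraph V × SimpleGraph V => x.1 ⊔ x.2 := .of_discrete
  have := Measure.isProbabilityMeasure_map (μ := G(V, p₁).prod G(V, p₂)) hsup.aemeasurable
  have hIic : ∀ (q : I) (Γ : SimpleGraph V),
      G(V, q) (Set.Iic Γ) = (toNNReal (σ q) : ENNReal) ^ Γᶜ.edgeSet.ncard := by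
    intro q Γ
    rw [← binomialRandom_disjoint]
    simp only [← le_compl_iff_disjoint_right, compl_compl, Set.Iic_def]
  refine measure_ext_of_Iic _ _ fun Γ => ?_
  have hpre : (fun x : SimpleGraph V × SimpleGraph V => x.1 ⊔ x.2) ⁻¹' Set.Iic Γ =
      Set.Iic Γ ×ˢ Set.Iic Γ := by
    ext
    simp [Prod.le_def]
  rw [Measure.map_apply hsup .of_discrete, hpre, Measure.prod_prod, hIic, hIic, hIic, ← mul_pow,
    ← ENNReal.coe_mul, h]
  rfl

theorem binomialRandom_real_le_of_sup [Finite V] {p p₁ p₂ : I} (h : σ p = σ p₁ * σ p₂)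
    (A B : Set (SimpleGraph V)) {b : ℝ} (hb₀ : 0 ≤ b)
    (hb : ∀ Γ₁ ∉ B, G(V, p₂).real {Γ₂ | Γ₁ ⊔ Γ₂ ∈ A} ≤ b) :
    G(V, p).real A ≤ G(V, p₁).real B + b := by
  have hbound : ∀ Γ₁, G(V, p₂) {Γ₂ | Γ₁ ⊔ Γ₂ ∈ A} ≤ B.indicator 1 Γ₁ + ENNReal.ofReal b := by
    intro Γ₁
    by_cases hΓ₁ : Γ₁ ∈ B
    · simpa [hΓ₁] using prob_le_one.trans le_self_add
    · simpa [hΓ₁] using (ENNReal.le_ofReal_iff_toReal_le (measure_ne_top _ _) hb₀).2 (hb Γ₁ hΓ₁)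
  have hA : G(V, p) A ≤ G(V, p₁) B + ENNReal.ofReal b := by
    rw [binomialRandom_eq_map_sup h, Measure.map_apply .of_discrete .of_discrete,
      Measure.prod_apply .of_discrete]
    refine (lintegral_mono hbound).trans_eq ?_
    rw [lintegral_add_right _ measurable_const, lintegral_indicator_one .of_discrete]
    simp
  rw [← ENNReal.toReal_ofReal hb₀, measureReal_def, measureReal_def,
    ← ENNReal.toReal_add (measure_ne_top _ _) ENNReal.ofReal_ne_top]
  exact ENNReal.toReal_mono (by finiteness) hA

theorem exists_symm_eq_symm_mul_symm (p : I) : ∃ q : I, (p : ℝ) / 2 ≤ q ∧ σ p = σ q * σ q := by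
  have hsq : √(1 - p : ℝ) ^ 2 = 1 - p := Real.sq_sqrt (by linarith [p.2.2])
  have hle : √(1 - p : ℝ) ≤ 1 := Real.sqrt_le_one.2 (by linarith [p.2.1])
  refine ⟨σ ⟨√(1 - p), Real.sqrt_nonneg _, hle⟩, ?_, ?_⟩
  · rw [coe_symm_eq]
    nlinarith [Real.sqrt_nonneg (1 - p : ℝ)]
  · ext
    simp [← sq, hsq]

theorem binomialRandom_real_disjoint_le [Fintype V] (p : I) {D : SimpleGraph V} {c : ℝ}
    (hD : HasDensity c fun x : V × V => D.Adj x.1 x.2) :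
    G(V, p).real {Γ | Disjoint Γ D} ≤ Real.exp (-(p * c * Fintype.card V ^ 2 / 2)) := by
  classical
  have hedges : c * Fintype.card V ^ 2 ≤ 2 * D.edgeSet.ncard := by
    rw [hasDensity_iff_card_filter, ← D.two_mul_card_edgeFinset, Fintype.card_prod] at hD
    rw [Set.ncard_eq_toFinset_card', ← SimpleGraph.edgeFinset]
    push_cast at hD
    linarith
  have hbase : (σ p : ℝ) ≤ Real.exp (-p) := by
    rw [coe_symm_eq]
    linarith [Real.add_one_le_exp (-(p : ℝ))]
  calc G(V, p).real {Γ | Disjoint Γ D} = (σ p : ℝ) ^ D.edgeSet.ncard := by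
        simp [measureReal_def, binomialRandom_disjoint]
    _ ≤ Real.exp (-p) ^ D.edgeSet.ncard := pow_le_pow_left₀ (σ p).2.1 hbase _
    _ = Real.exp (-(p * D.edgeSet.ncard)) := by rw [← Real.exp_nat_mul]; ring_nf
    _ ≤ _ := by
      gcongr
      linarith [mul_le_mul_of_nonneg_left hedges p.2.1]

theorem two_pow_le_exp (n : ℕ) : (2 : ℝ) ^ n ≤ Real.exp n := by
  rw [← Real.exp_one_pow]
  gcongr
  linarith [Real.add_one_le_exp (1 : ℝ)]

theorem natCast_pow_le_exp (n m : ℕ) : (n : ℝ) ^ m ≤ Real.exp (m * n) := by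
  rw [Real.exp_nat_mul]
  gcongr
  linarith [Real.add_one_le_exp (n : ℝ)]

/-- If fewer than `c / 2 * Fintype.card V` vertices `u` are good, then no edge of `Γ` lies in the
dense set of pairs of `R` whose first vertex is outside the set `X` of good vertices. -/
theorem binomialRandom_real_not_hasDensity_le [Fintype V] {p : I} {c C : ℝ} (hc : 0 < c)
    (hV : 4 ≤ c * Fintype.card V) (hp : C ≤ p * Fintype.card V) {R : V × V → Prop}
    (hR : HasDensity c R) :
    G(V, p).real {Γ | ¬HasDensity (c / 2) fun u => ∃ v, R (u, v) ∧ Γ.Adj u v} ≤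
      Real.exp ((1 - C * c / 8) * Fintype.card V) := by
  classical
  set n : ℝ := (Fintype.card V : ℝ)
  let D (X : Finset V) : SimpleGraph V := SimpleGraph.fromRel fun u v => u ∉ X ∧ R (u, v)
  have hD : ∀ X : Finset V, #X ≤ c / 2 * n →
      HasDensity (c / 4) fun x : V × V => (D X).Adj x.1 x.2 := by
    intro X hX
    have hoffdiag : HasDensity (1 - c / 4) fun x : V × V => x ∉ Finset.univ.diag (α := V) := by
      refine hasDensity_notMem ?_
      rw [Finset.diag_card, Finset.card_univ, Fintype.card_prod, Nat.cast_mul]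
      nlinarith
    refine (((hR.inter (hasDensity_notMem hX).comp_fst).inter hoffdiag).mono_left
      (by linarith)).mono fun x hx => ?_
    exact (SimpleGraph.fromRel_adj ..).2 ⟨by simpa using hx.2, .inl ⟨hx.1.2, hx.1.1⟩⟩
  have hsub : {Γ : SimpleGraph V | ¬HasDensity (c / 2) fun u => ∃ v, R (u, v) ∧ Γ.Adj u v} ⊆
      {Γ | ∃ X : Finset V, #X ≤ c / 2 * n ∧ Disjoint Γ (D X)} := by
    intro Γ hΓ
    refine ⟨({u | ∃ v, R (u, v) ∧ Γ.Adj u v} : Finset V),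
      (not_le.1 (hasDensity_iff_card_filter.not.1 hΓ)).le,
      SimpleGraph.disjoint_left.2 fun u v huv hD => ?_⟩
    rcases ((SimpleGraph.fromRel_adj ..).1 hD).2 with ⟨hu, hR⟩ | ⟨hv, hR⟩
    · exact hu (by simpa using ⟨v, hR, huv⟩)
    · exact hv (by simpa using ⟨u, hR, huv.symm⟩)
  calc _ ≤ G(V, p).real {Γ | ∃ X : Finset V, #X ≤ c / 2 * n ∧ Disjoint Γ (D X)} :=
        measureReal_mono hsub
    _ ≤ Fintype.card (Finset V) * Real.exp (-(p * (c / 4) * n ^ 2 / 2)) :=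
        measureReal_exists_le _ (Real.exp_nonneg _) fun X hX =>
          binomialRandom_real_disjoint_le p (hD X hX)
    _ ≤ Real.exp n * Real.exp (-(C * c / 8 * n)) := by
        rw [Fintype.card_finset]
        push_cast
        gcongr
        · exact two_pow_le_exp _
        · nlinarith [mul_le_mul_of_nonneg_right hp (by positivity : 0 ≤ c / 8 * n)]
    _ = _ := by rw [← Real.exp_add]; ring_nf

theorem binomialRandom_real_not_hasDensity_prod_le {Ω : Type*} [Fintype Ω] [Fintype V] {p : I}
    {c C : ℝ} (hc : 0 < c) (hV : 8 ≤ c * Fintype.card V) (hp : C ≤ p * Fintype.card V)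
    {R : Ω × V × V → Prop} (hR : HasDensity c R) :
    G(V, p).real {Γ | ¬HasDensity (c ^ 2 / 8) fun x : Ω × V =>
      ∃ v, R (x.1, x.2, v) ∧ Γ.Adj x.2 v} ≤
      Fintype.card Ω * Real.exp ((1 - C * c / 16) * Fintype.card V) := by
  have : Nonempty V := Fintype.card_pos_iff.1 <| Nat.pos_of_ne_zero fun h => by
    norm_num [h] at hV
  let Bad (Γ : SimpleGraph V) (ω : Ω) : Prop :=
    ¬HasDensity (c / 2 / 2) fun u => ∃ v, R (ω, u, v) ∧ Γ.Adj u v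
  have hsub : {Γ : SimpleGraph V | ¬HasDensity (c ^ 2 / 8) fun x : Ω × V =>
      ∃ v, R (x.1, x.2, v) ∧ Γ.Adj x.2 v} ⊆
      {Γ | ∃ ω, (HasDensity (c / 2) fun x => R (ω, x)) ∧ Bad Γ ω} := by
    intro Γ hΓ
    by_contra hgood
    simp only [Set.mem_ofPred_eq, Bad, not_exists, not_and, not_not] at hgood
    have hprod := (hR.curry hc.le).prod (by positivity) hgood
    exact hΓ ((hprod.mono_left (by linarith)).mono fun x hx => hx.2)
  have hBad : ∀ ω, (HasDensity (c / 2) fun x => R (ω, x)) →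
      G(V, p).real {Γ | Bad Γ ω} ≤ Real.exp ((1 - C * (c / 2) / 8) * Fintype.card V) :=
    fun ω hω => binomialRandom_real_not_hasDensity_le (R := fun x => R (ω, x)) (by positivity)
      (by linarith) hp hω
  refine (measureReal_mono hsub).trans
    ((measureReal_exists_le _ (Real.exp_nonneg _) hBad).trans_eq ?_)
  ring_nf

/-- Exposing the random edges between the first vertex and vertex `e` of the tuples of a dense
family `F` leaves a dense family of tuples that can be prolonged by such an edge. -/
theorem binomialRandom_real_not_hasDensity_cons_le [Fintype V] {p : I} {c C : ℝ} (hc : 0 < c)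
    (hV : 8 ≤ c * Fintype.card V) (hp : C ≤ p * Fintype.card V) {M : ℕ} (e : Fin M)
    {F : (Fin (M + 1) → V) → Prop} (hF : HasDensity c F) :
    G(V, p).real {Γ | ¬HasDensity (c ^ 2 / 8) fun f : Fin M → V =>
      ∃ v, F (Fin.cons v f) ∧ Γ.Adj (f e) v} ≤
      Real.exp ((M - C * c / 16) * Fintype.card V) := by
  let E : ({j // j ≠ e} → V) × V ≃ (Fin M → V) :=
    (Equiv.prodComm _ _).trans (Equiv.funSplitAt e V).symm
  let E' : ({j // j ≠ e} → V) × V × V ≃ (Fin (M + 1) → V) :=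
    (Equiv.prodAssoc _ _ _).symm.trans ((E.prodCongr (Equiv.refl V)).trans
      ((Equiv.prodComm _ _).trans (Fin.consEquiv fun _ => V)))
  have hE (x) : E x e = x.2 := by simp [E, Equiv.funSplitAt]
  have hR : HasDensity c fun x => F (E' x) := HasDensity.of_equiv E'.symm (by simpa using hF)
  have hM : 1 ≤ M := Fin.pos e
  calc _ ≤ G(V, p).real {Γ | ¬HasDensity (c ^ 2 / 8) fun x : ({j // j ≠ e} → V) × V =>
          ∃ v, F (E' (x.1, x.2, v)) ∧ Γ.Adj x.2 v} := by
        refine measureReal_mono fun Γ hΓ h => hΓ (HasDensity.of_equiv E (h.mono ?_))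
        rintro x ⟨v, hv, hadj⟩
        exact ⟨v, hv, (hE x).symm ▸ hadj⟩
    _ ≤ (Fintype.card V : ℝ) ^ (M - 1) * Real.exp ((1 - C * c / 16) * Fintype.card V) := by
        refine (binomialRandom_real_not_hasDensity_prod_le hc hV hp hR).trans_eq ?_
        simp
    _ ≤ Real.exp ((M - 1 : ℕ) * Fintype.card V) *
          Real.exp ((1 - C * c / 16) * Fintype.card V) := by
        gcongr
        exact natCast_pow_le_exp _ _
    _ = _ := by rw [← Real.exp_add, Nat.cast_sub hM]; ring_nf

/-- The vertices `f i, f (i + r), f (i + 2 * r), …` form a path in `Γ` for every `i`. -/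
def HasBraid (Γ : SimpleGraph V) (r : ℕ) {M : ℕ} (f : Fin M → V) : Prop :=
  ∀ i j : Fin M, (i : ℕ) + r = j → Γ.Adj (f i) (f j)

theorem setOf_not_exists_hasBraid_eq_empty {r M : ℕ} (h : M ≤ r) {F : (Fin M → V) → Prop}
    (hF : ∃ f, F f) : {Γ | ¬∃ f, F f ∧ HasBraid Γ r f} = ∅ := by
  obtain ⟨f, hf⟩ := hF
  exact Set.eq_empty_of_forall_notMem fun Γ hΓ => hΓ ⟨f, hf, fun _ _ hij => by lia⟩

theorem HasBraid.cons {Γ Γ' : SimpleGraph V} {r M : ℕ} {f : Fin M → V} {v : V} {e : Fin M}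
    (hf : HasBraid Γ r f) (he : (e : ℕ) + 1 = r) (hv : Γ'.Adj v (f e)) :
    HasBraid (Γ' ⊔ Γ) r (Fin.cons v f : Fin (M + 1) → V) := by
  intro i j hij
  cases j using Fin.cases with
  | zero => exact absurd hij (by simp only [Fin.val_zero]; lia)
  | succ j =>
    rw [Fin.val_succ] at hij
    cases i using Fin.cases with
    | zero =>
      obtain rfl : e = j := Fin.ext (by rw [Fin.val_zero] at hij; lia)
      exact .inl hv
    | succ i => exact .inr (hf i j (by rw [Fin.val_succ] at hij; lia))

theorem exists_binomialRandom_real_not_hasBraid_le.{u} (r : ℕ) (L : ℝ) (M : ℕ) {c : ℝ}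
    (hc : 0 < c) :
    ∃ C : ℝ, ∀ {V : Type u} [Fintype V] (p : I), C ≤ p * Fintype.card V →
      ∀ F : (Fin M → V) → Prop, HasDensity c F →
      G(V, p).real {Γ | ¬∃ f, F f ∧ HasBraid Γ (r + 1) f} ≤
        M * Real.exp (-(L * Fintype.card V)) := by
  induction M generalizing c with
  | zero =>
    refine ⟨0, fun p _ F hF => ?_⟩
    rw [setOf_not_exists_hasBraid_eq_empty (Nat.zero_le _) (hF.exists_of_pos hc), measureReal_empty,
      Nat.cast_zero, zero_mul]
  | succ M ih =>
    obtain ⟨C, hC⟩ := ih (c := c ^ 2 / 8) (by positivity)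
    refine ⟨2 * max C (max (8 / c) (16 * (M + L) / c)), fun {V} _ p hp F hF => ?_⟩
    obtain ⟨q, hpq, hq⟩ := exists_symm_eq_symm_mul_symm p
    have hqV : max C (max (8 / c) (16 * (M + L) / c)) ≤ q * Fintype.card V := by
      linarith [mul_le_mul_of_nonneg_right hpq (Nat.cast_nonneg (α := ℝ) (Fintype.card V))]
    simp only [max_le_iff] at hqV
    have hcV : 8 ≤ c * Fintype.card V := by
      rw [← div_le_iff₀' hc]
      exact hqV.2.1.trans (mul_le_of_le_one_left (Nat.cast_nonneg _) q.2.2)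
    rcases le_or_gt M r with hMr | hrM
    · have : Nonempty V := Fintype.card_pos_iff.1 <| Nat.pos_of_ne_zero fun h => by
        norm_num [h] at hcV
      rw [setOf_not_exists_hasBraid_eq_empty (Nat.succ_le_succ hMr) (hF.exists_of_pos hc),
        measureReal_empty]
      positivity
    let F' (Γ : SimpleGraph V) (f : Fin M → V) : Prop :=
      ∃ v, F (Fin.cons v f) ∧ Γ.Adj (f ⟨r, hrM⟩) v
    have hcons : G(V, q).real {Γ | ¬HasDensity (c ^ 2 / 8) (F' Γ)} ≤
        Real.exp (-(L * Fintype.card V)) := by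
      refine (binomialRandom_real_not_hasDensity_cons_le hc hcV hqV.2.2 _ hF).trans_eq ?_
      field_simp
      ring_nf
    have htail : ∀ Γ₁ ∉ {Γ | ¬HasDensity (c ^ 2 / 8) (F' Γ)},
        G(V, q).real {Γ₂ | Γ₁ ⊔ Γ₂ ∈ {Γ | ¬∃ f, F f ∧ HasBraid Γ (r + 1) f}} ≤
          M * Real.exp (-(L * Fintype.card V)) := by
      intro Γ₁ hΓ₁
      refine (measureReal_mono fun Γ₂ hΓ₂ => ?_).trans (hC q hqV.1 (F' Γ₁) (not_not.1 hΓ₁))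
      rintro ⟨f, ⟨v, hF, hadj⟩, hf⟩
      exact hΓ₂ ⟨Fin.cons v f, hF, hf.cons rfl hadj.symm⟩
    refine (binomialRandom_real_le_of_sup hq _ _ (by positivity) htail).trans ?_
    push_cast
    linarith

end RandomGraph

section PowerPaths

variable {V : Type*} {m r : ℕ}

theorem val_le_of_walk_pathGraph {u v : Fin m} (w : (SimpleGraph.pathGraph m).Walk u v) :
    (v : ℕ) ≤ u + w.length := by
  induction w with
  | nil => simp
  | cons h _ ih =>
    rw [SimpleGraph.Walk.length_cons]
    have hadj := SimpleGraph.pathGraph_adj.1 h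
    lia

theorem val_le_of_edist_pathGraph_le {u v : Fin m}
    (h : (SimpleGraph.pathGraph m).edist u v ≤ r) : (v : ℕ) ≤ u + r := by
  obtain ⟨w, hw⟩ := SimpleGraph.exists_walk_of_edist_ne_top
    (ne_top_of_le_ne_top (ENat.natCast_ne_top r) h)
  rw [← hw] at h
  exact (val_le_of_walk_pathGraph w).trans (Nat.add_le_add_left (mod_cast h) _)

theorem pathGraph_power_le_comap {H : SimpleGraph V} {f : Fin m → V}
    (hf : ∀ s t : Fin m, s < t → (t : ℕ) ≤ s + r → H.Adj (f s) (f t)) :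
    (SimpleGraph.pathGraph m).power r ≤ H.comap f := by
  rintro s t ⟨hne, hdist⟩
  rcases lt_or_gt_of_ne hne with hlt | hlt
  · exact hf s t hlt (val_le_of_edist_pathGraph_le hdist)
  · rw [SimpleGraph.edist_comm] at hdist
    exact (hf t s hlt (val_le_of_edist_pathGraph_le hdist)).symm

theorem adj_of_isFullStep {H : SimpleGraph V} {W : Fin (m + 1) → Fin r → V}
    (hclique : ∀ a, IsOrderedClique H (W a))
    (hstep : ∀ a : Fin m, IsFullStep H (W a.castSucc) (W a.succ)) {a b : Fin (m + 1)} {i j : Fin r}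
    (hlt : (i + r * a : ℕ) < j + r * b) (hle : (j + r * b : ℕ) ≤ i + r * a + r) :
    H.Adj (W a i) (W b j) := by
  have hab : (a : ℕ) ≤ b := by
    by_contra! hba
    have hmul := Nat.mul_le_mul_left r (Nat.succ_le_of_lt hba)
    rw [Nat.mul_succ] at hmul
    lia
  have hba : (b : ℕ) ≤ a + 1 := by
    by_contra! hab
    have hmul := Nat.mul_le_mul_left r (Nat.succ_le_of_lt hab)
    rw [Nat.mul_succ, Nat.mul_succ] at hmul
    lia
  rcases hab.eq_or_lt with heq | hlt'
  · obtain rfl := Fin.ext heq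
    exact (hclique a i j fun hij => by subst hij; exact lt_irrefl _ hlt).2
  · have hb : (b : ℕ) = a + 1 := by lia
    have ha : (a : ℕ) < m := by lia
    rw [hb, Nat.mul_succ] at hle
    obtain rfl : b = (⟨a, ha⟩ : Fin m).succ := Fin.ext hb
    exact hstep ⟨a, ha⟩ i j (Fin.le_def.2 (by lia))

theorem exists_powerPath_connects {H : SimpleGraph V} {W : Fin (m + 1) → Fin r → V}
    (hclique : ∀ a, IsOrderedClique H (W a))
    (hstep : ∀ a : Fin m, IsFullStep H (W a.castSucc) (W a.succ))
    (hinj : Function.Injective (Function.uncurry W)) :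
    ∃ P : PowerPath H r, P.Connects (W 0) (W (Fin.last m)) ∧
      Set.range P.copy = Set.range (Function.uncurry W) := by
  let e : Fin (m + 1) × Fin r ≃ Fin ((m + 1) * r) := finProdFinEquiv
  have hadj : ∀ s t : Fin ((m + 1) * r), s < t → (t : ℕ) ≤ s + r →
      H.Adj (Function.uncurry W (e.symm s)) (Function.uncurry W (e.symm t)) := by
    intro s t hlt hle
    obtain ⟨⟨a, i⟩, rfl⟩ := e.surjective s
    obtain ⟨⟨b, j⟩, rfl⟩ := e.surjective t
    rw [e.symm_apply_apply, e.symm_apply_apply]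
    exact adj_of_isFullStep hclique hstep hlt hle
  let P : PowerPath H r :=
    ⟨(m + 1) * r, ⟨⟨fun t => Function.uncurry W (e.symm t),
      fun h => pathGraph_power_le_comap hadj h⟩, hinj.comp e.symm.injective⟩⟩
  have hP : ∀ a i, P.copy (e (a, i)) = W a i := fun a i => by
    change Function.uncurry W (e.symm (e (a, i))) = W a i
    rw [e.symm_apply_apply]
    rfl
  refine ⟨P, ⟨Nat.le_mul_of_pos_left r m.succ_pos, fun i => ?_, fun i => ?_⟩,
    e.symm.surjective.range_comp (Function.uncurry W)⟩
  · rw [← hP]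
    exact congrArg P.copy (Fin.ext (by simp [e]))
  · rw [← hP]
    refine congrArg P.copy (Fin.ext ?_)
    simp only [P, e, finProdFinEquiv_apply_val, Fin.val_last, Nat.succ_mul, Nat.add_sub_cancel]
    ring

theorem injective_uncurry_cons {K : Fin r → V} {B : Fin m → Fin r → V}
    (hK : Function.Injective K) (hB : Function.Injective (Function.uncurry B))
    (hBK : ∀ a i, B a i ∉ Set.range K) :
    Function.Injective (Function.uncurry (Fin.cons K B : Fin (m + 1) → Fin r → V)) := by
  rintro ⟨a, i⟩ ⟨b, j⟩ h
  cases a using Fin.cases <;> cases b using Fin.cases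
  · exact Prod.ext rfl (hK h)
  · exact absurd ⟨i, h⟩ (hBK _ j)
  · exact absurd ⟨j, h.symm⟩ (hBK _ i)
  · simpa [Prod.ext_iff] using hB (a₁ := (_, i)) (a₂ := (_, j)) h

theorem injective_uncurry_snoc {B : Fin m → Fin r → V} {K : Fin r → V}
    (hB : Function.Injective (Function.uncurry B)) (hK : Function.Injective K)
    (hBK : ∀ a i, B a i ∉ Set.range K) :
    Function.Injective (Function.uncurry (Fin.snoc B K : Fin (m + 1) → Fin r → V)) := by
  rintro ⟨a, i⟩ ⟨b, j⟩ h
  cases a using Fin.lastCases <;> cases b using Fin.lastCases <;>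
    simp only [Function.uncurry_apply_pair, Fin.snoc_last, Fin.snoc_castSucc] at h
  · exact Prod.ext rfl (hK h)
  · exact absurd ⟨i, h⟩ (hBK _ j)
  · exact absurd ⟨j, h.symm⟩ (hBK _ i)
  · simpa [Prod.ext_iff] using hB (a₁ := (_, i)) (a₂ := (_, j)) h

theorem isFullStep_of_isWalk_of_hasBraid {G Γ : SimpleGraph V} {B : Fin (m + 1) → Fin r → V}
    (hB : IsWalk G (List.ofFn B))
    (hbraid : HasBraid Γ r fun t => Function.uncurry B (finProdFinEquiv.symm t)) (a : Fin m) :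
    IsFullStep (G ⊔ Γ) (B a.castSucc) (B a.succ) := by
  intro i j hji
  rcases hji.lt_or_eq with hlt | rfl
  · have hstep := List.isChain_iff_getElem.1 hB.1 a (by simp)
    simp only [List.getElem_ofFn] at hstep
    exact .inl (hstep i j hlt)
  · have hadj := hbraid (finProdFinEquiv (a.castSucc, j)) (finProdFinEquiv (a.succ, j)) (by
      simp only [finProdFinEquiv_apply_val, Fin.val_castSucc, Fin.val_succ]
      ring)
    simp only [Equiv.symm_apply_apply] at hadj
    exact .inr hadj

theorem rel_cons_of_rel {α : Type*} {R : α → α → Prop} {x : α} {f : Fin (m + 1) → α}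
    (hx : R x (f 0)) (hf : ∀ a : Fin m, R (f a.castSucc) (f a.succ)) (a : Fin (m + 1)) :
    R ((Fin.cons x f : Fin (m + 2) → α) a.castSucc) ((Fin.cons x f : Fin (m + 2) → α) a.succ) := by
  cases a using Fin.cases with
  | zero => exact hx
  | succ a => exact hf a

theorem rel_snoc_of_rel {α : Type*} {R : α → α → Prop} {f : Fin (m + 1) → α} {x : α}
    (hf : ∀ a : Fin m, R (f a.castSucc) (f a.succ)) (hx : R (f (Fin.last m)) x) (a : Fin (m + 1)) :
    R ((Fin.snoc f x : Fin (m + 2) → α) a.castSucc) ((Fin.snoc f x : Fin (m + 2) → α) a.succ) := by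
  cases a using Fin.lastCases with
  | last => simpa only [Fin.snoc_castSucc, Fin.succ_last, Fin.snoc_last] using hx
  | cast a => simpa only [Fin.succ_castSucc, Fin.snoc_castSucc] using hf a

theorem range_uncurry_cons_snoc (K K' : Fin r → V) (B : Fin m → Fin r → V) :
    Set.range (Function.uncurry (Fin.cons K (Fin.snoc B K' : Fin (m + 1) → Fin r → V) :
      Fin (m + 2) → Fin r → V)) =
      Set.range (Function.uncurry B) ∪ (Set.range K ∪ Set.range K') := by
  ext v
  simp only [Set.mem_range, Set.mem_union, Prod.exists, Function.uncurry_apply_pair]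
  rw [Fin.exists_fin_succ, Fin.exists_fin_succ']
  simp only [Fin.cons_zero, Fin.cons_succ, Fin.snoc_castSucc, Fin.snoc_last]
  exact or_left_comm

theorem IsConnector.exists_powerPath {G Γ : SimpleGraph V} {K K' : Fin r → V}
    {B : Fin (m + 2) → Fin r → V} (hB : IsConnector G K K' B)
    (hbraid : HasBraid Γ r fun t => Function.uncurry B (finProdFinEquiv.symm t))
    (hinj : Function.Injective (Function.uncurry B)) (hK : IsOrderedClique (G ⊔ Γ) K)
    (hK' : IsOrderedClique (G ⊔ Γ) K') (hKK' : Disjoint (Set.range K) (Set.range K'))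
    (hBK : ∀ b i, B b i ∉ Set.range K) (hBK' : ∀ b i, B b i ∉ Set.range K') :
    ∃ P : PowerPath (G ⊔ Γ) r, P.Connects K K' ∧
      P.internalVertices K K' = Set.range (Function.uncurry B) := by
  let W : Fin (m + 4) → Fin r → V := Fin.cons K (Fin.snoc B K' : Fin (m + 3) → Fin r → V)
  have hclique : ∀ a, IsOrderedClique (G ⊔ Γ) (W a) := by
    refine Fin.forall_fin_succ.2 ⟨hK, Fin.forall_fin_succ'.2 ⟨fun a => ?_, ?_⟩⟩
    · simp only [W, Fin.cons_succ, Fin.snoc_castSucc]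
      exact fun i j hij => (hB.isWalk.2 (B a) (List.mem_ofFn.2 ⟨a, rfl⟩) i j hij).imp_right .inl
    · simpa only [W, Fin.cons_succ, Fin.snoc_last] using hK'
  have hstep : ∀ a : Fin (m + 3), IsFullStep (G ⊔ Γ) (W a.castSucc) (W a.succ) :=
    rel_cons_of_rel (fun i j hij => .inl (hB.first i j hij))
      (rel_snoc_of_rel (isFullStep_of_isWalk_of_hasBraid hB.isWalk hbraid)
        fun i j hij => .inl (hB.last i j hij))
  have hW : Function.Injective (Function.uncurry W) := by
    refine injective_uncurry_cons hK.injective (injective_uncurry_snoc hinj hK'.injective hBK')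
      (Fin.forall_fin_succ'.2 ⟨fun a => ?_, ?_⟩)
    · rw [Fin.snoc_castSucc]
      exact hBK a
    · rw [Fin.snoc_last]
      exact fun i hi => Set.disjoint_left.1 hKK' hi ⟨i, rfl⟩
  obtain ⟨P, hP, hrange⟩ := exists_powerPath_connects hclique hstep hW
  refine ⟨P, by simpa [W] using hP, ?_⟩
  rw [PowerPath.internalVertices, hrange, range_uncurry_cons_snoc, Set.union_sdiff_right,
    sdiff_eq_left, Set.disjoint_union_right, Set.disjoint_left, Set.disjoint_left]
  exact ⟨Set.forall_mem_range.2 fun b => hBK b.1 b.2, Set.forall_mem_range.2 fun b => hBK' b.1 b.2⟩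

end PowerPaths

section ConnectingPaths

open MeasureTheory unitInterval
open scoped Finset SimpleGraph

universe u

/-- The event of the connecting lemma: in the graph `H`, every two vertex-disjoint ordered
`(k + 1)`-cliques are connected by a `(k + 1)`-path with `(k + 1) * 2 ^ (k + 1)` internal vertices,
none of which is in a prescribed set of at most `z` vertices. -/
def HasConnectingPaths {V : Type*} (H : SimpleGraph V) (k : ℕ) (z : ℝ) : Prop :=
  ∀ Z : Finset V, (#Z : ℝ) ≤ z → ∀ K K' : Fin (k + 1) → V,
    IsOrderedClique H K → IsOrderedClique H K' → Disjoint (Set.range K) (Set.range K') →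
    ∃ P : PowerPath H (k + 1), P.Connects K K' ∧
      (P.internalVertices K K').ncard = (k + 1) * 2 ^ (k + 1) ∧
      Disjoint (P.internalVertices K K') (Z : Set V)

/-- `B` is a connector from `K` to `K'` whose entries are distinct vertices outside `Z`, `K` and
`K'`. -/
structure IsAvoidingConnector {V : Type*} (G : SimpleGraph V) (Z : Finset V) {m r : ℕ}
    (K K' : Fin r → V) (B : Fin (m + 2) → Fin r → V) : Prop where
  isConnector : IsConnector G K K' B
  injective : Function.Injective (Function.uncurry B)
  notMem : ∀ b i, B b i ∉ Z
  notMem_range_left : ∀ b i, B b i ∉ Set.range K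
  notMem_range_right : ∀ b i, B b i ∉ Set.range K'

theorem hasConnectingPaths_of_forall_exists {V : Type*} {G Γ : SimpleGraph V} {k m : ℕ} {z : ℝ}
    (hm : m + 2 = 2 ^ (k + 1))
    (h : ∀ Z : Finset V, (#Z : ℝ) ≤ z → ∀ K K' : Fin (k + 1) → V,
      ∃ f : Fin ((m + 2) * (k + 1)) → V,
        IsAvoidingConnector G Z K K' (fun b i => f (finProdFinEquiv (b, i))) ∧
          HasBraid Γ (k + 1) f) :
    HasConnectingPaths (G ⊔ Γ) k z := by
  intro Z hZ K K' hK hK' hKK'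
  obtain ⟨f, hf, hbraid⟩ := h Z hZ K K'
  obtain ⟨P, hP, hint⟩ := hf.isConnector.exists_powerPath (Γ := Γ) (by
      simpa only [Function.uncurry, Prod.mk.eta, Equiv.apply_symm_apply] using hbraid)
    hf.injective hK hK' hKK' hf.notMem_range_left hf.notMem_range_right
  refine ⟨P, hP, ?_, ?_⟩
  · rw [hint, Set.ncard_range_of_injective hf.injective, Nat.card_eq_fintype_card,
      Fintype.card_prod, Fintype.card_fin, Fintype.card_fin, hm, mul_comm]
  · rw [hint, Set.disjoint_left]
    exact Set.forall_mem_range.2 fun b => hf.notMem b.1 b.2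

theorem hasDensity_adj_of_le_minDegree {V : Type*} [Fintype V] {G : SimpleGraph V}
    [DecidableRel G.Adj] {a : ℝ} (h : a * Fintype.card V ≤ G.minDegree) (v : V) :
    HasDensity a (G.Adj v) := by
  have hcard : Nat.card {u // G.Adj v u} = G.degree v :=
    Nat.card_eq_fintype_card.trans (G.card_neighborSet_eq_degree v)
  rw [HasDensity, hcard]
  exact h.trans (mod_cast G.minDegree_le_degree v)

theorem isRich_of_card_le {V : Type*} [Fintype V] [Nonempty V] {G : SimpleGraph V} {k : ℕ} {ε : ℝ}
    (hε : 0 < ε) (hG : ∀ v, HasDensity ((k : ℝ) / (k + 1) + ε) (G.Adj v)) {S : Finset V}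
    (hS : (#S : ℝ) ≤ 3 / 4 * ε * Fintype.card V) : IsRich G (ε / 4) (k + 1) {v | v ∉ S} := by
  have hk : (k : ℝ) / (k + 1) + ε = 1 - (1 / (k + 1) - ε) := by field_simp; ring
  rw [hk] at hG
  obtain ⟨v⟩ := ‹Nonempty V›
  have : Nonempty V := ⟨v⟩
  refine isRich_of_hasDensity (by linarith [(hG v).le_one]) hG ((hasDensity_notMem hS).mono_left ?_)
  have hkε : 0 ≤ k * ε := by positivity
  have hmul : ((k : ℝ) + 1) * (1 / (k + 1) - ε) = 1 - k * ε - ε := by field_simp; ring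
  push_cast
  linarith

theorem exists_hasDensity_isAvoidingConnector {ε : ℝ} (hε : 0 < ε) {k m : ℕ}
    (hm : m + 2 = 2 ^ (k + 1)) :
    ∃ c > 0, ∃ N : ℝ, ∀ {V : Type u} [Fintype V] (G : SimpleGraph V), N ≤ Fintype.card V →
      (∀ v, HasDensity ((k : ℝ) / (k + 1) + ε) (G.Adj v)) →
      ∀ Z : Finset V, #Z ≤ ε * Fintype.card V / 2 → ∀ K K' : Fin (k + 1) → V,
        HasDensity c fun B : Fin (m + 2) → Fin (k + 1) → V => IsAvoidingConnector G Z K K' B := by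
  classical
  obtain ⟨c, hc, hconn⟩ := exists_hasDensity_isConnector.{u} (γ := ε / 4) (by positivity) k m hm
  set M : ℝ := (Fintype.card (Fin (m + 2) × Fin (k + 1)) : ℝ)
  refine ⟨c / 2, half_pos hc, max 1 (max (8 * (k + 1) / ε) (M ^ 2 * 2 / c)),
    fun {V} _ G hN hG Z hZ K K' => ?_⟩
  set n : ℝ := (Fintype.card V : ℝ)
  obtain ⟨hn, hεn, hMn⟩ : 1 ≤ n ∧ 8 * (k + 1) / ε ≤ n ∧ M ^ 2 * 2 / c ≤ n := by
    simpa only [max_le_iff] using hN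
  rw [div_le_iff₀ hε] at hεn
  rw [div_le_iff₀ hc] at hMn
  have : Nonempty V := Fintype.card_pos_iff.1 (Nat.cast_pos.1 (one_pos.trans_le hn))
  set S : Finset V := Z ∪ (Finset.univ.image K ∪ Finset.univ.image K') with hS
  have hScard : (#S : ℝ) ≤ 3 / 4 * ε * n := by
    have hle : #S ≤ #Z + ((k + 1) + (k + 1)) := by
      refine (Finset.card_union_le _ _).trans (Nat.add_le_add_left ((Finset.card_union_le _ _).trans
        (Nat.add_le_add ?_ ?_)) _) <;> exact Finset.card_image_le.trans_eq (Finset.card_fin _)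
    have hle' : (#S : ℝ) ≤ #Z + ((k + 1) + (k + 1)) := mod_cast hle
    linarith
  have hinj : HasDensity (1 - c / 2) fun B : Fin (m + 2) → Fin (k + 1) → V =>
      Function.Injective (Function.uncurry B) := by
    refine .of_equiv (Equiv.curry _ _ _) ((hasDensity_injective _).mono_left ?_)
    rw [sub_le_sub_iff_left, div_le_iff₀ (one_pos.trans_le hn)]
    linarith
  refine (((hconn G _ (isRich_of_card_le hε hG hScard) K K').inter hinj).mono_left
    (by linarith)).mono fun B ⟨⟨hBS, hB⟩, hBinj⟩ => ?_
  simp only [hS, Set.mem_ofPred_eq, Finset.mem_union, Finset.mem_image, Finset.mem_univ, true_and,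
    not_or] at hBS
  exact ⟨hB, hBinj, fun b i => (hBS b i).1, fun b i => (hBS b i).2.1, fun b i => (hBS b i).2.2⟩

theorem card_finset_prod_cliques_le_exp (V : Type*) [Fintype V] (r : ℕ) :
    (Fintype.card (Finset V × (Fin r → V) × (Fin r → V)) : ℝ) ≤
      Real.exp ((2 * r + 1) * Fintype.card V) := by
  set n := Fintype.card V
  calc (Fintype.card (Finset V × (Fin r → V) × (Fin r → V)) : ℝ) = 2 ^ n * (n ^ r * n ^ r) := by
        simp [n]
    _ ≤ Real.exp n * (Real.exp (r * n) * Real.exp (r * n)) := by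
        gcongr
        exacts [two_pow_le_exp n, natCast_pow_le_exp n r, natCast_pow_le_exp n r]
    _ = Real.exp ((2 * r + 1) * n) := by
        rw [← Real.exp_add, ← Real.exp_add]
        ring_nf

theorem exists_binomialRandom_real_not_hasConnectingPaths_le (k : ℕ) {ε : ℝ} (hε : 0 < ε) :
    ∃ C M : ℝ, ∀ {V : Type u} [Fintype V] (G : SimpleGraph V) (p : I),
      (∀ v, HasDensity ((k : ℝ) / (k + 1) + ε) (G.Adj v)) → C ≤ p * Fintype.card V →
      G(V, p).real {Γ | ¬HasConnectingPaths (G ⊔ Γ) k (ε * Fintype.card V / 2)} ≤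
        M * Real.exp (-Fintype.card V) := by
  classical
  obtain ⟨m, hm⟩ : ∃ m, m + 2 = 2 ^ (k + 1) :=
    ⟨_, Nat.sub_add_cancel (Nat.le_self_pow k.succ_ne_zero 2)⟩
  obtain ⟨c, hc, N, hconn⟩ := exists_hasDensity_isAvoidingConnector.{u} hε hm
  obtain ⟨C, hbraid⟩ := exists_binomialRandom_real_not_hasBraid_le.{u} k
    (2 * (k + 1 : ℕ) + 2) ((m + 2) * (k + 1)) hc
  set M : ℝ := (((m + 2) * (k + 1) : ℕ) : ℝ)
  refine ⟨max C N, M, fun {V} _ G p hG hp => ?_⟩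
  set n : ℝ := (Fintype.card V : ℝ)
  have hN : N ≤ n := (le_of_max_le_right hp).trans (mul_le_of_le_one_left (by positivity) p.2.2)
  let F (x : Finset V × (Fin (k + 1) → V) × (Fin (k + 1) → V)) (f : Fin ((m + 2) * (k + 1)) → V) :=
    IsAvoidingConnector G x.1 x.2.1 x.2.2 fun b i => f (finProdFinEquiv (b, i))
  have hF : ∀ x, #x.1 ≤ ε * n / 2 → HasDensity c (F x) := fun x hx =>
    .of_equiv ((Equiv.curry _ _ _).symm.trans (finProdFinEquiv.arrowCongr (.refl V)))
      (by simpa [F] using hconn G hN hG x.1 hx x.2.1 x.2.2)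
  have hcover : {Γ | ¬HasConnectingPaths (G ⊔ Γ) k (ε * n / 2)} ⊆
      {Γ | ∃ x, #x.1 ≤ ε * n / 2 ∧ ¬∃ f, F x f ∧ HasBraid Γ (k + 1) f} := by
    intro Γ hΓ
    by_contra hnot
    exact hΓ <| hasConnectingPaths_of_forall_exists hm fun Z hZ K K' =>
      by_contra fun hf => hnot ⟨(Z, K, K'), hZ, hf⟩
  calc G(V, p).real {Γ | ¬HasConnectingPaths (G ⊔ Γ) k (ε * n / 2)}
      ≤ G(V, p).real {Γ | ∃ x, #x.1 ≤ ε * n / 2 ∧ ¬∃ f, F x f ∧ HasBraid Γ (k + 1) f} :=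
        measureReal_mono hcover
    _ ≤ _ := measureReal_exists_le _ (by positivity) fun x hx =>
        hbraid p (le_of_max_le_left hp) (F x) (hF x hx)
    _ ≤ Real.exp ((2 * (k + 1 : ℕ) + 1) * n) * (M * Real.exp (-((2 * (k + 1 : ℕ) + 2) * n))) := by
        gcongr
        exact card_finset_prod_cliques_le_exp V (k + 1)
    _ = M * Real.exp (-n) := by
        rw [mul_left_comm, ← Real.exp_add]
        ring_nf

end ConnectingPaths

theorem proposition2p1 (k : ℕ) (ε : ℝ) (hε : 0 < ε) :
    ∃ C : ℝ, 1 < C ∧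
      ∀ (G : (n : ℕ) → SimpleGraph (Fin n)) [∀ n, DecidableRel (G n).Adj] (p : ℕ → unitInterval),
        (∀ᶠ n : ℕ in Filter.atTop,
          ((k : ℝ) / ((k : ℝ) + 1) + ε) * (n : ℝ) ≤ ((G n).minDegree : ℝ)) →
        (∀ᶠ n : ℕ in Filter.atTop, C / (n : ℝ) ≤ (p n : ℝ)) →
        Filter.Tendsto
          (fun n : ℕ => SimpleGraph.binomialRandom (Fin n) (p n)
            {Γ : SimpleGraph (Fin n) |
              ∀ Z : Finset (Fin n), (Z.card : ℝ) ≤ ε * (n : ℝ) / 2 →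
              ∀ K K' : Fin (k + 1) → Fin n,
                IsOrderedClique (G n ⊔ Γ) K → IsOrderedClique (G n ⊔ Γ) K' →
                Disjoint (Set.range K) (Set.range K') →
                ∃ P : PowerPath (G n ⊔ Γ) (k + 1),
                  P.Connects K K' ∧
                  (P.internalVertices K K').ncard = (k + 1) * 2 ^ (k + 1) ∧
                  Disjoint (P.internalVertices K K') (Z : Set (Fin n))})
          Filter.atTop (nhds 1) := by
  obtain ⟨C, M, hfail⟩ := exists_binomialRandom_real_not_hasConnectingPaths_le k hε
  refine ⟨max C 2, lt_max_of_lt_right one_lt_two, fun G _ p hG hp => ?_⟩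
  refine (ENNReal.tendsto_toReal_iff (fun _ => MeasureTheory.measure_ne_top _ _)
    ENNReal.one_ne_top).1 ?_
  have hexp : Filter.Tendsto (fun n : ℕ => 1 - M * Real.exp (-n)) Filter.atTop (nhds 1) := by
    simpa using ((Real.tendsto_exp_neg_atTop_nhds_zero.comp
      tendsto_natCast_atTop_atTop).const_mul M).const_sub 1
  refine tendsto_of_tendsto_of_tendsto_of_le_of_le' hexp tendsto_const_nhds ?_
    (.of_forall fun _ => MeasureTheory.measureReal_le_one)
  filter_upwards [hG, hp, Filter.eventually_gt_atTop 0] with n hGn hpn hn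
  have hCn : C ≤ p n * n :=
    (le_max_left C 2).trans ((div_le_iff₀ (Nat.cast_pos.2 hn)).1 hpn)
  have hbound := hfail (G n) (p n)
    (hasDensity_adj_of_le_minDegree (by rwa [Fintype.card_fin])) (by rwa [Fintype.card_fin])
  rw [Fintype.card_fin, ← Set.compl_ofPred, MeasureTheory.probReal_compl_eq_one_sub
    (Set.toFinite _).measurableSet] at hbound
  exact sub_le_comm.1 hbound
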